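/- Let $G\subsetneq\mathbb{R}^2$ be a simply connected domain. Write $\partial G$ for the boundary of $G$ in $\mathbb{R}^2\cup\{\infty\}$ and $\delta(x)$ for the Euclidean distance from $x\in G$ to $\partial G$. For $x,y\in G$ let $$\alpha_G(x,y)=\sup_{a,b\in\partial G}\log\frac{|a-y|\,|b-x|}{|a-x|\,|b-y|}$$ (with $|\infty-u|/|\infty-v|=1$) be the Apollonian metric, $$j_G(x,y)=\log\Bigl(1+\frac{|x-y|}{\min\{\delta(x),\delta(y)\}}\Bigr),\qquad k_G(x,y)=\inf_\gamma\int_\gamma\frac{|dz|}{\delta(z)}$$ the $j$ metric and the quasihyperbolic metric, and $\tilde\alpha_G(x,y)=\inf_\gamma\alpha_G(\gamma)$ the Apollonian inner metric. Here both infima are over all rectifiable paths $\gamma:[0,1]\to G$ from $x$ to $y$, and $\alpha_G(\gamma)=\sup\sum_{i<k}\alpha_G(\gamma(t_i),\gamma(t_{i+1}))$ over all finite subdivisions $0=t_0<\dots<t_k=1$. For functions $d,d'$ on $G\times G$ write $d\lesssim d'$ if there is a constant $K>0$ with $d(x,y)\le K\,d'(x,y)$ for all $x,y\in G$; write $d\approx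 d'$ if $d\lesssim d'$ and $d'\lesssim d$; write $d\ll d'$ if $d\lesssim d'$ but not $d'\lesssim d$. The domain $G$ has the comparison property if $\alpha_G\approx j_G$. (a) If $G$ does not have the comparison property, then $\tilde\alpha_G\not\lesssim j_G$. (b) Neither Inequality 11, $\alpha_G\approx\tilde\alpha_G\ll j_G\ll k_G$, nor Inequality 12, $\alpha_G\ll\tilde\alpha_G\ll j_G\ll k_G$, holds. -/

import Mathlib

open scoped ENNReal NNReal

noncomputable section

namespace ApollonianGeometry

/-- Euclidean `n`-space. -/
abbrev Euc (n : ℕ) : Type := EuclideanSpace ℝ (Fin n)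

/-- The boundary of `G ⊆ ℝⁿ` taken in the one-point compactification `ℝⁿ ∪ {∞}`. -/
def sphereBoundary {n : ℕ} (G : Set (Euc n)) : Set (OnePoint (Euc n)) :=
  frontier ((fun x : Euc n => (x : OnePoint (Euc n))) '' G)

/-- The quotient `|a - u| / |a - v|`, which is `1` by convention for `a = ∞`. -/
def distRatio {n : ℕ} : OnePoint (Euc n) → Euc n → Euc n → ℝ
  | none, _, _ => 1
  | some a, u, v => dist a u / dist a v

/-- The Apollonian metric
`α_G(x, y) = sup_{a, b ∈ ∂G} log (|a - y| |b - x| / (|a - x| |b - y|))`,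
as an element of `[0, ∞]`. Negative logarithms are truncated at `0`, which does not change the
supremum, since `a = b` contributes `log 1 = 0`. -/
def apollonian {n : ℕ} (G : Set (Euc n)) (x y : Euc n) : ℝ≥0∞ :=
  ⨆ a ∈ sphereBoundary G, ⨆ b ∈ sphereBoundary G,
    ENNReal.ofReal (Real.log (distRatio a y x * distRatio b x y))

/-- The Euclidean distance `δ(x)` from `x` to the (finite points of the) boundary of `G`. -/
def boundaryDist {n : ℕ} (G : Set (Euc n)) (x : Euc n) : ℝ :=
  Metric.infDist x (frontier G)

/-- The metric `j_G(x, y) = log (1 + |x - y| / min {δ(x), δ(y)})`. -/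
def jMetric {n : ℕ} (G : Set (Euc n)) (x y : Euc n) : ℝ≥0∞ :=
  ENNReal.ofReal (Real.log (1 + dist x y / min (boundaryDist G x) (boundaryDist G y)))

/-- The Euclidean length of a path. -/
def eucLength {n : ℕ} {x y : Euc n} (γ : Path x y) : ℝ≥0∞ :=
  eVariationOn γ.extend (Set.Icc 0 1)

/-- `γ` is an admissible path in `G`: it stays in `G` and has finite Euclidean length. -/
def IsRectifiablePathIn {n : ℕ} (G : Set (Euc n)) {x y : Euc n} (γ : Path x y) : Prop :=
  (∀ t, γ t ∈ G) ∧ eucLength γ ≠ ∞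

/-- The `d`-length of a path: the supremum of `∑ d(γ(tᵢ), γ(tᵢ₊₁))` over all finite subdivisions
`0 = t₀ < t₁ < ⋯ < tₖ = 1`. -/
def dLength {n : ℕ} (d : Euc n → Euc n → ℝ≥0∞) {x y : Euc n} (γ : Path x y) : ℝ≥0∞ :=
  ⨆ (k : ℕ) (t : Fin (k + 1) → unitInterval) (_ : StrictMono t) (_ : t 0 = 0)
    (_ : t (Fin.last k) = 1), ∑ i : Fin k, d (γ (t i.castSucc)) (γ (t i.succ))

/-- The inner metric of `d` in `G`: the infimum of the `d`-lengths of the rectifiable paths in `G`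
from `x` to `y`. -/
def innerMetric {n : ℕ} (G : Set (Euc n)) (d : Euc n → Euc n → ℝ≥0∞) (x y : Euc n) : ℝ≥0∞ :=
  ⨅ (γ : Path x y) (_ : IsRectifiablePathIn G γ), dLength d γ

/-- The Apollonian inner metric. -/
def apollonianInner {n : ℕ} (G : Set (Euc n)) : Euc n → Euc n → ℝ≥0∞ :=
  innerMetric G (apollonian G)

/-- The integral `∫_γ ρ |dz|` of a weight along a rectifiable path with respect to arc length,
computed in the arc-length parametrization. -/
def arcLengthIntegral {n : ℕ} (ρ : Euc n → ℝ≥0∞) {x y : Euc n} (γ : Path x y) : ℝ≥0∞ :=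
  ∫⁻ s in Set.Icc 0 (eucLength γ).toReal,
    ρ (naturalParameterization γ.extend (Set.Icc 0 1) 0 s)

/-- The quasihyperbolic metric: the infimum of `∫_γ |dz| / δ(z)` over the rectifiable paths in `G`
from `x` to `y`. -/
def quasihyperbolic {n : ℕ} (G : Set (Euc n)) (x y : Euc n) : ℝ≥0∞ :=
  ⨅ (γ : Path x y) (_ : IsRectifiablePathIn G γ),
    arcLengthIntegral (fun z => (ENNReal.ofReal (boundaryDist G z))⁻¹) γ

/-- `d ≲ d'` on `G`: there is a finite constant `K > 0` with `d ≤ K d'`. -/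
def Dominated {n : ℕ} (G : Set (Euc n)) (d d' : Euc n → Euc n → ℝ≥0∞) : Prop :=
  ∃ K : ℝ≥0, 0 < K ∧ ∀ x ∈ G, ∀ y ∈ G, d x y ≤ (K : ℝ≥0∞) * d' x y

/-- `d ≈ d'` on `G`. -/
def Comparable {n : ℕ} (G : Set (Euc n)) (d d' : Euc n → Euc n → ℝ≥0∞) : Prop :=
  Dominated G d d' ∧ Dominated G d' d

/-- `d ≪ d'` on `G`: `d ≲ d'` but not `d' ≲ d`. -/
def StrictlyDominated {n : ℕ} (G : Set (Euc n)) (d d' : Euc n → Euc n → ℝ≥0∞) : Prop :=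
  Dominated G d d' ∧ ¬ Dominated G d' d

/-- The comparison property `α_G ≈ j_G`. -/
def ComparisonProperty {n : ℕ} (G : Set (Euc n)) : Prop :=
  Comparable G (apollonian G) (jMetric G)

/-- Inequality 11: `α_G ≈ α̃_G ≪ j_G ≪ k_G`. -/
def Inequality11 {n : ℕ} (G : Set (Euc n)) : Prop :=
  Comparable G (apollonian G) (apollonianInner G) ∧
    StrictlyDominated G (apollonianInner G) (jMetric G) ∧
    StrictlyDominated G (jMetric G) (quasihyperbolic G)

/-- Inequality 12: `α_G ≪ α̃_G ≪ j_G ≪ k_G`. -/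
def Inequality12 {n : ℕ} (G : Set (Euc n)) : Prop :=
  StrictlyDominated G (apollonian G) (apollonianInner G) ∧
    StrictlyDominated G (apollonianInner G) (jMetric G) ∧
    StrictlyDominated G (jMetric G) (quasihyperbolic G)

end ApollonianGeometry

end

namespace Complex

open Set

/-- Two continuous branches of the logarithm on a preconnected set have the same increments of
the argument. -/
theorem im_sub_im_eq_of_exp_eq {S : Set ℂ} (hS : IsPreconnected S) {g h : ℂ → ℂ}
    (hg : ContinuousOn g S) (hh : ContinuousOn h S) (hge : ∀ z ∈ S, exp (g z) = z)
    (hhe : ∀ z ∈ S, exp (h z) = z) {z w : ℂ} (hz : z ∈ S) (hw : w ∈ S) :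
    (g z).im - (g w).im = (h z).im - (h w).im := by
  have hd : DiscreteTopology (range ((↑) : ℤ → ℝ)) :=
    Int.isClosedEmbedding_coe_real.isEmbedding.toHomeomorph.symm.isEmbedding.discreteTopology
  have hc : ContinuousOn (fun z => ((g z).im - (h z).im) / (2 * Real.pi)) S :=
    ((continuous_im.comp_continuousOn hg).sub (continuous_im.comp_continuousOn hh)).div_const _
  have hm : MapsTo (fun z => ((g z).im - (h z).im) / (2 * Real.pi)) S
      (range ((↑) : ℤ → ℝ)) := by
    intro z hz
    obtain ⟨n, hn⟩ := exp_eq_exp_iff_exists_int.1 ((hge z hz).trans (hhe z hz).symm)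
    refine ⟨n, ?_⟩
    have him : (g z).im = (h z).im + n * (2 * Real.pi) := by
      rw [hn]; simp
    have hpi := Real.pi_pos
    simp only [him]
    field_simp
    ring
  have key := hS.constant_of_mapsTo ⟨hd⟩ hc hm hz hw
  have hpi := Real.pi_pos
  field_simp at key
  linarith

/-- If a set `H` carrying a branch of the logarithm contains the parts of a disc above and below a
thin strip around the real axis, then near `1` or near `-1` the two parts are not joined by a
connected subset of `H`. -/
theorem exists_not_joined_of_log {H : Set ℂ} {g : ℂ → ℂ} (hg : ContinuousOn g H)
    (hge : ∀ z ∈ H, exp (g z) = z) {ε : ℝ} (hε : 0 < ε) (hε' : ε < 1 / 8)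
    (hup : ∀ z : ℂ, ‖z‖ < 3 → ε < z.im → z ∈ H)
    (hlo : ∀ z : ℂ, ‖z‖ < 3 → z.im < -ε → z ∈ H) :
    ∃ σ : ℝ, |σ| = 1 ∧ ∀ S : Set ℂ, IsPreconnected S → S ⊆ H → (⟨σ, 2 * ε⟩ : ℂ) ∈ S →
      (⟨σ, -(2 * ε)⟩ : ℂ) ∈ S → ∃ z ∈ S, 1 / 2 ≤ ‖z - σ‖ := by
  by_contra! hcon
  obtain ⟨S, hS, hSH, hS1, hS2, hSb⟩ := hcon 1 (by simp)
  obtain ⟨T, hT, hTH, hT1, hT2, hTb⟩ := hcon (-1) (by simp)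
  have nrm : ∀ σ τ : ℝ, |σ| = 1 → |τ| < 1 → ‖(⟨σ, τ⟩ : ℂ)‖ < 3 := by
    intro σ τ hσ hτ
    refine (norm_le_abs_re_add_abs_im _).trans_lt ?_
    simp only [hσ]
    linarith
  have habs : |2 * ε| < 1 := by rw [abs_of_pos (by positivity)]; linarith
  have habs' : |-(2 * ε)| < 1 := by rwa [abs_neg]
  have hcu : IsPreconnected {z : ℂ | ‖z‖ < 3 ∧ ε < z.im} := by
    have : {z : ℂ | ‖z‖ < 3 ∧ ε < z.im} = Metric.ball 0 3 ∩ {z : ℂ | ε < z.im} := by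
      ext; simp
    rw [this]
    exact ((convex_ball _ _).inter (convex_halfSpace_im_gt _)).isPreconnected
  have hcl : IsPreconnected {z : ℂ | ‖z‖ < 3 ∧ z.im < -ε} := by
    have : {z : ℂ | ‖z‖ < 3 ∧ z.im < -ε} = Metric.ball 0 3 ∩ {z : ℂ | z.im < -ε} := by
      ext; simp
    rw [this]
    exact ((convex_ball _ _).inter (convex_halfSpace_im_lt _)).isPreconnected
  have hlog : ∀ s : Set ℂ, s ⊆ slitPlane → ContinuousOn log s := fun s hs z hz =>
    (continuousAt_clog (hs hz)).continuousWithinAt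
  have hexp : ∀ s : Set ℂ, s ⊆ slitPlane → ∀ z ∈ s, exp (log z) = z := fun s hs z hz =>
    exp_log (slitPlane_ne_zero (hs hz))
  have hU : {z : ℂ | ‖z‖ < 3 ∧ ε < z.im} ⊆ slitPlane := fun z hz =>
    Or.inr (hε.trans hz.2).ne'
  have hL : {z : ℂ | ‖z‖ < 3 ∧ z.im < -ε} ⊆ slitPlane := fun z hz =>
    Or.inr (hz.2.trans (neg_neg_of_pos hε)).ne
  have hSs : S ⊆ slitPlane := fun z hz => by
    have h := (abs_re_le_norm _).trans_lt (hSb z hz)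
    simp only [sub_re, ofReal_re] at h
    exact Or.inl (by linarith [(abs_lt.1 h).1])
  have hTs : ∀ z ∈ T, -z ∈ slitPlane := fun z hz => by
    have h := (abs_re_le_norm _).trans_lt (hTb z hz)
    simp only [sub_re, ofReal_re] at h
    exact Or.inl (by rw [neg_re]; linarith [(abs_lt.1 h).2])
  have e1 := im_sub_im_eq_of_exp_eq hcu (hg.mono fun z hz => hup z hz.1 hz.2) (hlog _ hU)
    (fun z hz => hge z (hup z hz.1 hz.2)) (hexp _ hU)
    (z := ⟨-1, 2 * ε⟩) (w := ⟨1, 2 * ε⟩)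
    ⟨nrm _ _ (by simp) habs, by simp only; linarith⟩
    ⟨nrm _ _ (by simp) habs, by simp only; linarith⟩
  have e2 := im_sub_im_eq_of_exp_eq hcl (hg.mono fun z hz => hlo z hz.1 hz.2) (hlog _ hL)
    (fun z hz => hge z (hlo z hz.1 hz.2)) (hexp _ hL)
    (z := ⟨1, -(2 * ε)⟩) (w := ⟨-1, -(2 * ε)⟩)
    ⟨nrm _ _ (by simp) habs', by simp only; linarith⟩
    ⟨nrm _ _ (by simp) habs', by simp only; linarith⟩
  have e3 := im_sub_im_eq_of_exp_eq hS (hg.mono hSH) (hlog _ hSs)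
    (fun z hz => hge z (hSH hz)) (hexp _ hSs) hS1 hS2
  have e4 := im_sub_im_eq_of_exp_eq hT (h := fun z => log (-z) + Real.pi * I) (hg.mono hTH)
    (fun z hz => (((continuousAt_clog (hTs z hz)).comp continuousAt_neg).add
      continuousAt_const).continuousWithinAt)
    (fun z hz => hge z (hTH hz))
    (fun z hz => by rw [exp_add, exp_pi_mul_I, exp_log (slitPlane_ne_zero (hTs z hz))]; ring)
    hT2 hT1
  have n1 : (⟨1, -(2 * ε)⟩ : ℂ) = (starRingEnd ℂ) ⟨1, 2 * ε⟩ := rfl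
  have n2 : (⟨-1, 2 * ε⟩ : ℂ) = -⟨1, -(2 * ε)⟩ := by apply Complex.ext <;> simp
  have n3 : (⟨-1, -(2 * ε)⟩ : ℂ) = -⟨1, 2 * ε⟩ := by apply Complex.ext <;> simp
  have hpos : (⟨1, 2 * ε⟩ : ℂ).arg ≠ Real.pi := by
    have := (abs_arg_lt_pi_div_two_iff (z := ⟨1, 2 * ε⟩)).2 (Or.inl (by simp))
    have := (abs_lt.1 this).2
    have := Real.pi_pos
    linarith
  have m1 : (⟨1, -(2 * ε)⟩ : ℂ).arg = -(⟨1, 2 * ε⟩ : ℂ).arg := by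
    rw [n1, arg_conj, if_neg hpos]
  have m2 : (⟨-1, 2 * ε⟩ : ℂ).arg = (⟨1, -(2 * ε)⟩ : ℂ).arg + Real.pi := by
    rw [n2]; exact arg_neg_eq_arg_add_pi_of_im_neg (by simpa using hε)
  have m3 : (⟨-1, -(2 * ε)⟩ : ℂ).arg = (⟨1, 2 * ε⟩ : ℂ).arg - Real.pi := by
    rw [n3]; exact arg_neg_eq_arg_sub_pi_of_im_pos (by simpa using hε)
  simp only [log_im, add_im] at e1 e2 e3 e4
  have p1 : -(⟨-1, 2 * ε⟩ : ℂ) = ⟨1, -(2 * ε)⟩ := by rw [n2, neg_neg]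
  have p2 : -(⟨-1, -(2 * ε)⟩ : ℂ) = ⟨1, 2 * ε⟩ := by rw [n3, neg_neg]
  rw [p1, p2] at e4
  have := Real.pi_pos
  linarith

end Complex

namespace ApollonianGeometry

open Set Topology Filter

/-- A preconnected set that meets `G` but not the frontier of `G` lies in `G`. -/
theorem subset_of_disjoint_frontier {X : Type*} [TopologicalSpace X] {S G : Set X}
    (hS : IsPreconnected S) (hG : IsOpen G) (hne : (S ∩ G).Nonempty)
    (hd : ∀ z ∈ S, z ∉ frontier G) : S ⊆ G := by
  refine hS.subset_of_closure_inter_subset hG hne ?_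
  rintro z ⟨hz, hzS⟩
  by_contra hzG
  exact hd z hzS ⟨hz, by rwa [hG.interior_eq]⟩

variable {n : ℕ} {G : Set (Euc n)}

theorem coe_mem_sphereBoundary_iff {a : Euc n} :
    (a : OnePoint (Euc n)) ∈ sphereBoundary G ↔ a ∈ frontier G := by
  have h := OnePoint.isOpenMap_coe.preimage_frontier_eq_frontier_preimage
    (OnePoint.continuous_coe (X := Euc n)) ((fun x : Euc n => (x : OnePoint (Euc n))) '' G)
  rw [preimage_image_eq _ OnePoint.coe_injective] at h
  rw [← h]
  rfl

theorem infty_mem_sphereBoundary (hG : ¬ Bornology.IsBounded G) :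
    OnePoint.infty ∈ sphereBoundary G := by
  refine ⟨?_, fun h => OnePoint.infty_notMem_image_coe (interior_subset h)⟩
  rw [mem_closure_iff_frequently]
  intro hev
  have h := (OnePoint.tendsto_coe_infty (X := Euc n)).eventually hev
  rw [coclosedCompact_eq_cocompact] at h
  obtain ⟨K, hK, hKG⟩ := mem_cocompact.1 h
  refine hG (hK.isBounded.subset fun x hx => ?_)
  by_contra hxK
  exact hKG hxK ⟨x, hx, rfl⟩

theorem ofReal_log_le_apollonian {a b : OnePoint (Euc n)} (ha : a ∈ sphereBoundary G)
    (hb : b ∈ sphereBoundary G) (x y : Euc n) :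
    ENNReal.ofReal (Real.log (distRatio a y x * distRatio b x y)) ≤ apollonian G x y :=
  le_iSup₂_of_le a ha (le_iSup₂_of_le b hb le_rfl)

theorem apollonian_comm (x y : Euc n) : apollonian G x y = apollonian G y x := by
  have key : ∀ x y : Euc n, apollonian G x y ≤ apollonian G y x := fun x y =>
    iSup₂_le fun a ha => iSup₂_le fun b hb => by
      rw [mul_comm]
      exact ofReal_log_le_apollonian hb ha y x
  exact le_antisymm (key x y) (key y x)

theorem jMetric_comm (x y : Euc n) : jMetric G x y = jMetric G y x := by
  rw [jMetric, jMetric, dist_comm, min_comm]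

theorem le_dLength (d : Euc n → Euc n → ℝ≥0∞) {x y : Euc n} (γ : Path x y)
    {t : unitInterval} (ht : 0 < t) : d x (γ t) ≤ dLength d γ := by
  rcases (unitInterval.le_one' (t := t)).eq_or_lt with rfl | h1
  · refine le_trans ?_ (le_iSup_of_le 1 (le_iSup_of_le ![0, 1] (le_iSup_of_le ?_
      (le_iSup_of_le rfl (le_iSup_of_le rfl le_rfl)))))
    · simp
    · simp [Fin.strictMono_iff_lt_succ]
  · refine le_trans ?_ (le_iSup_of_le 2 (le_iSup_of_le ![0, t, 1] (le_iSup_of_le ?_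
      (le_iSup_of_le rfl (le_iSup_of_le rfl le_rfl)))))
    · simp [Fin.sum_univ_two]
    · rw [Fin.strictMono_iff_lt_succ]
      intro i
      fin_cases i
      · exact ht
      · exact h1

theorem le_innerMetric (d : Euc n → Euc n → ℝ≥0∞) (x y : Euc n) : d x y ≤ innerMetric G d x y := by
  refine le_iInf₂ fun γ _ => ?_
  have h := le_dLength d γ (t := 1) zero_lt_one
  rwa [γ.target] at h

theorem ball_boundaryDist_subset (hG : IsOpen G) {x : Euc n} (hx : x ∈ G) :
    Metric.ball x (boundaryDist G x) ⊆ G := by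
  rcases le_or_gt (boundaryDist G x) 0 with h | h
  · rw [Metric.ball_eq_empty.2 h]; exact empty_subset _
  · refine subset_of_disjoint_frontier (convex_ball _ _).isPreconnected hG
      ⟨x, Metric.mem_ball_self h, hx⟩ fun z hz hzf => ?_
    have := Metric.infDist_le_dist_of_mem (x := x) hzf
    rw [Metric.mem_ball, dist_comm] at hz
    exact absurd (this.trans_lt hz) (lt_irrefl _)

theorem frontier_nonempty (hne : G.Nonempty) (hproper : G ≠ univ) : (frontier G).Nonempty :=
  nonempty_frontier_iff.2 ⟨hne, hproper⟩

theorem boundaryDist_pos (hG : IsOpen G) (hproper : G ≠ univ) {x : Euc n} (hx : x ∈ G) :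
    0 < boundaryDist G x := by
  refine (isClosed_frontier.notMem_iff_infDist_pos (frontier_nonempty ⟨x, hx⟩ hproper)).1
    fun h => ?_
  rw [hG.frontier_eq] at h
  exact h.2 hx

/-- Some point of the boundary, possibly `∞`, is at least as far from `x` as from `y`. -/
theorem exists_one_le_distRatio (hG : IsOpen G) {x y : Euc n} (hy : y ∈ G) (hxy : x ≠ y) :
    ∃ b ∈ sphereBoundary G, 1 ≤ distRatio b x y := by
  by_cases h : ∃ t : ℝ, 0 ≤ t ∧ y + t • (y - x) ∈ frontier G
  · obtain ⟨t, ht, hb⟩ := h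
    refine ⟨_, coe_mem_sphereBoundary_iff.2 hb, ?_⟩
    change 1 ≤ dist (y + t • (y - x)) x / dist (y + t • (y - x)) y
    have hne : y + t • (y - x) ≠ y := fun h => by
      rw [h, hG.frontier_eq] at hb
      exact hb.2 hy
    rw [one_le_div (dist_pos.2 hne), dist_eq_norm, dist_eq_norm]
    have e1 : y + t • (y - x) - x = (1 + t) • (y - x) := by module
    have e2 : y + t • (y - x) - y = t • (y - x) := by module
    rw [e1, e2, norm_smul, norm_smul, Real.norm_of_nonneg ht, Real.norm_of_nonneg (by linarith)]
    gcongr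
    linarith
  · push Not at h
    refine ⟨OnePoint.infty, infty_mem_sphereBoundary fun hbd => ?_, le_rfl⟩
    have hsub : (fun t : ℝ => y + t • (y - x)) '' Ici 0 ⊆ G := by
      refine subset_of_disjoint_frontier (isPreconnected_Ici.image _ (by fun_prop)) hG
        ⟨y, ⟨0, by simp, by simp⟩, hy⟩ ?_
      rintro _ ⟨t, ht, rfl⟩
      exact h t ht
    obtain ⟨C, hC⟩ := hbd.exists_norm_le
    have hv : 0 < ‖y - x‖ := norm_pos_iff.2 (sub_ne_zero.2 hxy.symm)
    have hC0 : 0 ≤ C := (norm_nonneg _).trans (hC y hy)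
    set t := (C + ‖y‖ + 1) / ‖y - x‖
    have ht : 0 ≤ t := by positivity
    have h1 := hC _ (hsub ⟨t, ht, rfl⟩)
    have h2 : ‖t • (y - x)‖ = C + ‖y‖ + 1 := by
      rw [norm_smul, Real.norm_of_nonneg ht]
      exact div_mul_cancel₀ _ hv.ne'
    have h3 := norm_sub_le (y + t • (y - x)) y
    rw [add_sub_cancel_left] at h3
    linarith

end ApollonianGeometry

namespace ApollonianGeometry

open Set Topology Filter

variable {G : Set (Euc 2)}

/-- The similarity `z ↦ a + δ L z` of `ℂ` onto the plane. -/
noncomputable def similarity (a : Euc 2) {δ : ℝ} (hδ : 0 < δ) (L : ℂ ≃ₗᵢ[ℝ] Euc 2) : ℂ ≃ₜ Euc 2 :=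
  (L.toHomeomorph.trans (Homeomorph.smulOfNeZero δ hδ.ne')).trans (Homeomorph.addLeft a)

theorem similarity_apply (a : Euc 2) {δ : ℝ} (hδ : 0 < δ) (L : ℂ ≃ₗᵢ[ℝ] Euc 2) (z : ℂ) :
    similarity a hδ L z = a + δ • L z := rfl

theorem similarity_zero (a : Euc 2) {δ : ℝ} (hδ : 0 < δ) (L : ℂ ≃ₗᵢ[ℝ] Euc 2) :
    similarity a hδ L 0 = a := by
  simp [similarity_apply]

theorem dist_similarity (a : Euc 2) {δ : ℝ} (hδ : 0 < δ) (L : ℂ ≃ₗᵢ[ℝ] Euc 2) (z w : ℂ) :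
    dist (similarity a hδ L z) (similarity a hδ L w) = δ * ‖z - w‖ := by
  rw [similarity_apply, similarity_apply, dist_add_left, dist_smul₀, L.dist_map, dist_eq_norm,
    Real.norm_of_nonneg hδ.le]

/-- If the boundary of a simply connected domain lies in a thin strip near one of its points and
the domain contains both sides of the strip, then two points on opposite sides of the strip have
bounded `j`-distance but large Apollonian inner distance. -/
theorem exists_jMetric_le_and_le_apollonianInner (hG : IsOpen G) (hsc : IsSimplyConnected G)
    {a : Euc 2} (ha : a ∈ frontier G) {δ : ℝ} (hδ : 0 < δ) (L : ℂ ≃ₗᵢ[ℝ] Euc 2) {ε : ℝ}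
    (hε : 0 < ε) (hε' : ε ≤ 1 / 100)
    (hup : ∀ z : ℂ, ‖z‖ < 3 → ε < z.im → similarity a hδ L z ∈ G)
    (hlo : ∀ z : ℂ, ‖z‖ < 3 → z.im < -ε → similarity a hδ L z ∈ G) :
    ∃ x ∈ G, ∃ y ∈ G, jMetric G x y ≤ ENNReal.ofReal (Real.log 5) ∧
      ENNReal.ofReal (Real.log (1 / (16 * ε))) ≤ apollonianInner G x y := by
  set φ := similarity a hδ L with hφ
  have hφd : ∀ z w, dist (φ z) (φ w) = δ * ‖z - w‖ := dist_similarity a hδ L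
  have hφ0 : φ 0 = a := similarity_zero a hδ L
  have hfr : ∀ p ∈ frontier G, p ∉ G := fun p hp => by
    rw [hG.frontier_eq] at hp
    exact hp.2
  obtain ⟨g, hg, hge⟩ := Complex.exists_continuousOn_eqOn_exp_comp hsc hG
    (g := fun p => φ.symm p) φ.symm.continuous.continuousOn (by
      rintro ⟨p, hp, hp0⟩
      have : p = a := by rw [← hφ0, ← hp0, φ.apply_symm_apply]
      exact hfr a ha (this ▸ hp))
  obtain ⟨σ, hσ, hjoin⟩ := Complex.exists_not_joined_of_log (H := φ ⁻¹' G) (g := g ∘ φ)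
    (hg.comp φ.continuous.continuousOn fun z hz => hz)
    (fun z hz => by simpa using hge hz) hε (by linarith) hup hlo
  have hnorm : ∀ τ : ℝ, |τ| ≤ 3 * ε → ‖(⟨σ, τ⟩ : ℂ)‖ < 2 := fun τ hτ => by
    refine (Complex.norm_le_abs_re_add_abs_im _).trans_lt ?_
    simp only [hσ]
    linarith
  have hball : ∀ τ : ℝ, |τ| ≤ 3 * ε → ∀ z : ℂ, ‖z - ⟨σ, τ⟩‖ < ε → ‖z‖ < 3 := fun τ hτ z hz => by
    have := norm_sub_norm_le z ⟨σ, τ⟩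
    linarith [hnorm τ hτ]
  have hbd : ∀ z : ℂ, (∀ w, ‖w - z‖ < ε → φ w ∈ G) → δ * ε ≤ boundaryDist G (φ z) := by
    intro z hz
    refine (Metric.le_infDist ⟨a, ha⟩).2 fun p hp => ?_
    by_contra! hlt
    refine hfr p hp ?_
    rw [← φ.apply_symm_apply p, hφd] at hlt
    rw [← φ.apply_symm_apply p]
    refine hz _ ?_
    rw [norm_sub_rev]
    exact lt_of_mul_lt_mul_left hlt hδ.le
  have habs : |2 * ε| ≤ 3 * ε := by rw [abs_of_pos (by positivity)]; linarith
  have habs' : |-(2 * ε)| ≤ 3 * ε := by rwa [abs_neg]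
  set zx : ℂ := ⟨σ, 2 * ε⟩ with hzx
  set zy : ℂ := ⟨σ, -(2 * ε)⟩ with hzy
  have him : ∀ z w : ℂ, ‖z - w‖ < ε → |z.im - w.im| < ε := fun z w h =>
    (Complex.abs_im_le_norm (z - w)).trans_lt h
  have hbx := hbd zx fun w hw => hup w (hball _ habs w hw) (by
    have := (abs_lt.1 (him _ _ hw)).1
    simp only [hzx] at this
    linarith)
  have hby := hbd zy fun w hw => hlo w (hball _ habs' w hw) (by
    have := (abs_lt.1 (him _ _ hw)).2
    simp only [hzy] at this
    linarith)
  have hxG : φ zx ∈ G := hup zx ((hnorm _ habs).trans (by norm_num)) (by simp only [hzx]; linarith)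
  have hyG : φ zy ∈ G :=
    hlo zy ((hnorm _ habs').trans (by norm_num)) (by simp only [hzy]; linarith)
  have hsub : ∀ c d : ℝ, ‖(⟨σ, c⟩ : ℂ) - ⟨σ, d⟩‖ = |c - d| := fun c d => by
    have : (⟨σ, c⟩ : ℂ) - ⟨σ, d⟩ = ((c - d : ℝ) : ℂ) * Complex.I := by
      apply Complex.ext <;> simp
    rw [this, norm_mul, Complex.norm_I, mul_one, Complex.norm_real, Real.norm_eq_abs]
  refine ⟨φ zx, hxG, φ zy, hyG, ENNReal.ofReal_le_ofReal ?_, ?_⟩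
  · have h1 : dist (φ zx) (φ zy) = 4 * (δ * ε) := by
      rw [hφd, hsub, abs_of_pos (by linarith)]; ring
    have hm : δ * ε ≤ min (boundaryDist G (φ zx)) (boundaryDist G (φ zy)) := le_min hbx hby
    have hpos : 0 < δ * ε := by positivity
    have hxd : 0 < 1 + dist (φ zx) (φ zy) /
        min (boundaryDist G (φ zx)) (boundaryDist G (φ zy)) :=
      add_pos_of_pos_of_nonneg one_pos (div_nonneg dist_nonneg (hpos.le.trans hm))
    refine Real.log_le_log hxd ?_
    rw [h1]
    have : 4 * (δ * ε) / min (boundaryDist G (φ zx)) (boundaryDist G (φ zy)) ≤ 4 := by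
      rw [div_le_iff₀ (hpos.trans_le hm)]
      linarith
    linarith
  · -- a boundary point on the segment joining the two points
    obtain ⟨τ, hτ, hτf⟩ : ∃ τ : ℝ, |τ| ≤ 2 * ε ∧ φ ⟨σ, τ⟩ ∈ frontier G := by
      by_contra! hcon
      have hvert : Continuous fun τ : ℝ => (⟨σ, τ⟩ : ℂ) := by
        have : (fun τ : ℝ => (⟨σ, τ⟩ : ℂ)) = fun τ : ℝ => (σ : ℂ) + τ * Complex.I := by
          ext τ; apply Complex.ext <;> simp
        rw [this]; fun_prop
      set S := (fun τ : ℝ => (⟨σ, τ⟩ : ℂ)) '' Icc (-(2 * ε)) (2 * ε)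
      have hS : IsPreconnected S := isPreconnected_Icc.image _ hvert.continuousOn
      have hSx : zx ∈ S := ⟨2 * ε, ⟨by linarith, le_rfl⟩, rfl⟩
      have hSy : zy ∈ S := ⟨-(2 * ε), ⟨le_rfl, by linarith⟩, rfl⟩
      have hSG : φ '' S ⊆ G := by
        refine subset_of_disjoint_frontier (hS.image _ φ.continuous.continuousOn) hG
          ⟨φ zx, ⟨zx, hSx, rfl⟩, hxG⟩ ?_
        rintro _ ⟨_, ⟨τ, hτ, rfl⟩, rfl⟩
        exact hcon τ (abs_le.2 hτ)
      obtain ⟨_, ⟨τ, hτ, rfl⟩, hz⟩ := hjoin S hS (image_subset_iff.1 hSG) hSx hSy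
      have h0 : ((σ : ℝ) : ℂ) = ⟨σ, 0⟩ := rfl
      rw [h0, hsub, sub_zero] at hz
      have := abs_le.2 hτ
      linarith
    refine le_iInf₂ fun γ hγ => ?_
    obtain ⟨t, ht⟩ : ∃ t, 1 / 2 ≤ ‖φ.symm (γ t) - σ‖ := by
      have hS : IsPreconnected (range fun t => φ.symm (γ t)) :=
        isPreconnected_range (φ.symm.continuous.comp γ.continuous)
      obtain ⟨_, ⟨t, rfl⟩, h⟩ := hjoin _ hS (by
        rintro _ ⟨t, rfl⟩
        simpa using hγ.1 t) ⟨0, by simp⟩ ⟨1, by simp⟩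
      exact ⟨t, h⟩
    set z := φ.symm (γ t)
    have hz : φ z = γ t := φ.apply_symm_apply _
    have h0 : ((σ : ℝ) : ℂ) = ⟨σ, 0⟩ := rfl
    have ht0 : 0 < t := by
      refine unitInterval.pos_iff_ne_zero.2 fun h => ?_
      have : z = zx := by simp [z, h]
      rw [this, h0, hsub, sub_zero, abs_of_pos (by positivity)] at ht
      linarith
    refine le_trans (le_trans (ENNReal.ofReal_le_ofReal ?_) (ofReal_log_le_apollonian
      (coe_mem_sphereBoundary_iff.2 hτf) (coe_mem_sphereBoundary_iff.2 ha) (φ zx) (γ t)))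
      (le_dLength _ γ ht0)
    refine Real.log_le_log (by positivity) ?_
    change 1 / (16 * ε) ≤
      dist (φ ⟨σ, τ⟩) (γ t) / dist (φ ⟨σ, τ⟩) (φ zx) * (dist a (φ zx) / dist a (γ t))
    rw [← hz, ← hφ0, hφd, hφd, hφd, hφd, zero_sub, zero_sub, norm_neg, norm_neg, hsub,
      mul_div_mul_left _ _ hδ.ne', mul_div_mul_left _ _ hδ.ne']
    have k1 : |τ - 2 * ε| ≤ 4 * ε := by
      have := abs_le.1 hτ
      exact abs_le.2 ⟨by linarith, by linarith⟩
    have k1' : 0 < |τ - 2 * ε| := by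
      refine abs_pos.2 fun h => hfr _ hτf ?_
      rwa [sub_eq_zero.1 h]
    have k2 : 1 ≤ ‖zx‖ := by
      have := Complex.abs_re_le_norm zx
      rwa [show zx.re = σ from rfl, hσ] at this
    have k3 : ‖z - σ‖ ≤ ‖(⟨σ, τ⟩ : ℂ) - z‖ + 2 * ε := by
      have := norm_sub_le_norm_sub_add_norm_sub z ⟨σ, τ⟩ (σ : ℂ)
      rw [h0, hsub, sub_zero, norm_sub_rev z ⟨σ, τ⟩] at this
      rw [h0]
      linarith
    have k4 : ‖z‖ ≤ ‖(⟨σ, τ⟩ : ℂ) - z‖ + 1 + 2 * ε := by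
      have h1 := Complex.norm_le_abs_re_add_abs_im (⟨σ, τ⟩ : ℂ)
      have h2 := norm_sub_norm_le z ⟨σ, τ⟩
      rw [norm_sub_rev] at h2
      simp only [hσ] at h1
      linarith
    have k5 : 0 < ‖z‖ := by
      refine norm_pos_iff.2 fun h => hfr a ha ?_
      rw [← hφ0, ← h, hz]
      exact hγ.1 t
    rw [div_mul_div_comm, div_le_div_iff₀ (by positivity) (by positivity), one_mul]
    have k6 : ‖z‖ ≤ 4 * ‖(⟨σ, τ⟩ : ℂ) - z‖ := by linarith
    calc |τ - 2 * ε| * ‖z‖ ≤ (4 * ε) * (4 * ‖(⟨σ, τ⟩ : ℂ) - z‖) := by gcongr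
      _ = ‖(⟨σ, τ⟩ : ℂ) - z‖ * 1 * (16 * ε) := by ring
      _ ≤ _ := by gcongr

end ApollonianGeometry

namespace ApollonianGeometry

open Set

/-- The plane has linear isometric coordinates whose imaginary axis is spanned by a given unit
vector. -/
theorem exists_linearIsometryEquiv_inner_eq_im {u : Euc 2} (hu : ‖u‖ = 1) :
    ∃ L : ℂ ≃ₗᵢ[ℝ] Euc 2, ∀ z, inner ℝ (L z) u = z.im := by
  set E := Complex.orthonormalBasisOneI.repr
  set w := E.symm u
  have hw : ‖w * -Complex.I‖ = 1 := by simp [w, hu]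
  set c : Circle := ⟨w * -Complex.I, mem_sphere_zero_iff_norm.2 hw⟩
  refine ⟨(rotation c).trans E, fun z => ?_⟩
  have h : ((rotation c).trans E) Complex.I = u := by
    have hc : rotation c Complex.I = w := by
      rw [rotation_apply]
      change w * -Complex.I * Complex.I = w
      rw [mul_assoc, neg_mul, Complex.I_mul_I, neg_neg, mul_one]
    rw [LinearIsometryEquiv.trans_apply, hc]
    exact E.apply_symm_apply u
  conv_lhs => rw [← h]
  rw [LinearIsometryEquiv.inner_map_map, Complex.inner]
  simp

variable {G : Set (Euc 2)}

/-- An Apollonian bound `A` bounds the logarithm of `|a - y| / |a - x|` for every boundary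
point. -/
theorem abs_log_dist_div_dist_le (hG : IsOpen G) {x y : Euc 2} (hx : x ∈ G) (hy : y ∈ G)
    (hxy : x ≠ y) {A : ℝ} (hA : ∀ a ∈ sphereBoundary G, ∀ b ∈ sphereBoundary G,
      Real.log (distRatio a y x * distRatio b x y) ≤ A) {a : Euc 2} (ha : a ∈ frontier G) :
    |Real.log (dist a y / dist a x)| ≤ A := by
  have ha' := coe_mem_sphereBoundary_iff.2 ha
  rw [hG.frontier_eq] at ha
  have hax : 0 < dist a x := dist_pos.2 fun h => ha.2 (h ▸ hx)
  have hay : 0 < dist a y := dist_pos.2 fun h => ha.2 (h ▸ hy)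
  obtain ⟨b, hb, hb1⟩ := exists_one_le_distRatio hG hy hxy
  obtain ⟨c, hc, hc1⟩ := exists_one_le_distRatio hG hx hxy.symm
  refine abs_le'.2 ⟨le_trans ?_ (hA _ ha' b hb), le_trans ?_ (hA c hc _ ha')⟩
  · refine Real.log_le_log (by positivity) ?_
    exact le_mul_of_one_le_right (by positivity) hb1
  · rw [← Real.log_inv, inv_div]
    refine Real.log_le_log (by positivity) ?_
    exact le_mul_of_one_le_left (by positivity) hc1

theorem abs_sq_sub_sq_le_of_abs_log_le {p q A : ℝ} (hp : 0 < p) (hq : 0 < q) (hA : 2 * A ≤ 1)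
    (h : |Real.log (p / q)| ≤ A) : |p ^ 2 - q ^ 2| ≤ 4 * A * q ^ 2 := by
  have h2 : |2 * Real.log (p / q)| ≤ 2 * A := by
    rw [abs_mul, abs_two]; linarith
  have h3 := Real.abs_exp_sub_one_le (h2.trans hA)
  have h4 : Real.exp (2 * Real.log (p / q)) = (p / q) ^ 2 := by
    rw [two_mul, Real.exp_add, Real.exp_log (by positivity), sq]
  rw [h4] at h3
  have h5 : p ^ 2 - q ^ 2 = ((p / q) ^ 2 - 1) * q ^ 2 := by field_simp
  rw [h5, abs_mul, abs_of_nonneg (sq_nonneg q)]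
  exact mul_le_mul_of_nonneg_right (by linarith) (sq_nonneg q)

/-- If `A` is much smaller than `j_G(x, y)` and bounds the Apollonian distance, then `G` contains
both sides of a thin strip around a boundary point. -/
theorem exists_strip_of_le (hG : IsOpen G) (hproper : G ≠ univ) {x y : Euc 2} (hx : x ∈ G)
    (hy : y ∈ G) (hxy : x ≠ y) (hle : boundaryDist G x ≤ boundaryDist G y) {K ε : ℝ}
    (hK : 100 ≤ K) (hKε : 35 ≤ K * ε) (hε' : ε ≤ 1 / 4)
    (hA : ∀ a ∈ sphereBoundary G, ∀ b ∈ sphereBoundary G,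
      Real.log (distRatio a y x * distRatio b x y) ≤
        Real.log (1 + dist x y / boundaryDist G x) / K) :
    ∃ a ∈ frontier G, ∃ (δ : ℝ) (hδ : 0 < δ) (L : ℂ ≃ₗᵢ[ℝ] Euc 2),
      (∀ z : ℂ, ‖z‖ < 3 → ε < z.im → similarity a hδ L z ∈ G) ∧
      (∀ z : ℂ, ‖z‖ < 3 → z.im < -ε → similarity a hδ L z ∈ G) := by
  set δ := boundaryDist G x with hδdef
  set d := dist x y with hd
  have hδ : 0 < δ := boundaryDist_pos hG hproper hx
  have hd0 : 0 < d := dist_pos.2 hxy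
  have hK0 : 0 < K := by linarith
  set A := Real.log (1 + d / δ) / K
  have hfr : ∀ p ∈ frontier G, p ∉ G := fun p hp => by
    rw [hG.frontier_eq] at hp
    exact hp.2
  have hlog : ∀ a ∈ frontier G, |Real.log (dist a y / dist a x)| ≤ A := fun a ha =>
    abs_log_dist_div_dist_le hG hx hy hxy hA ha
  obtain ⟨a, ha, hax⟩ :=
    isClosed_frontier.exists_infDist_eq_dist (frontier_nonempty ⟨x, hx⟩ hproper) x
  replace hax : dist a x = δ := by rw [dist_comm, ← hax]; rfl
  have hd3 : d / δ ≤ 3 := by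
    by_contra! h3
    have h1 : d / δ - 1 ≤ dist a y / dist a x := by
      rw [hax, ← div_self hδ.ne', ← sub_div]
      gcongr
      have := dist_triangle_left x y a
      rw [hax] at this
      linarith
    have h2 := (Real.log_le_log (by linarith) h1).trans ((le_abs_self _).trans (hlog a ha))
    have h4 : A ≤ Real.log (1 + d / δ) / 2 :=
      div_le_div_of_nonneg_left (Real.log_nonneg (by linarith)) (by norm_num) (by linarith)
    have h5 : Real.log ((d / δ - 1) ^ 2) ≤ Real.log (1 + d / δ) := by
      rw [Real.log_pow]; push_cast; linarith
    have h6 := (Real.log_le_log_iff (by nlinarith) (by linarith)).1 h5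
    nlinarith
  have hAd : A ≤ d / δ / K := by
    refine div_le_div_of_nonneg_right ?_ hK0.le
    have := Real.log_le_sub_one_of_pos (show 0 < 1 + d / δ by positivity)
    linarith
  have hA3 : A ≤ 3 / 100 := hAd.trans (div_le_div₀ (by norm_num) hd3 (by norm_num) hK)
  have hsq : ∀ p ∈ frontier G, |dist p y ^ 2 - dist p x ^ 2| ≤ 4 * A * dist p x ^ 2 := fun p hp =>
    abs_sq_sub_sq_le_of_abs_log_le (dist_pos.2 fun h => hfr p hp (h ▸ hy))
      (dist_pos.2 fun h => hfr p hp (h ▸ hx)) (by linarith) (hlog p hp)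
  set u : Euc 2 := d⁻¹ • (x - y)
  have hdu : d • u = x - y := smul_inv_smul₀ hd0.ne' _
  have hu : ‖u‖ = 1 := by
    rw [norm_smul, norm_inv, Real.norm_of_nonneg hd0.le, ← dist_eq_norm]
    exact inv_mul_cancel₀ hd0.ne'
  have huu : inner ℝ u u = (1 : ℝ) := by rw [real_inner_self_eq_norm_sq, hu, one_pow]
  obtain ⟨L, hL⟩ := exists_linearIsometryEquiv_inner_eq_im hu
  set φ := similarity a hδ L with hφ
  have hφd : ∀ z w, dist (φ z) (φ w) = δ * ‖z - w‖ := dist_similarity a hδ L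
  have hφ0 : φ 0 = a := similarity_zero a hδ L
  have hφa : ∀ z, dist (φ z) a = δ * ‖z‖ := fun z => by
    rw [← hφ0, hφd, sub_zero]
  set h : Euc 2 → ℝ := fun p => inner ℝ (p - x) u + d / 2
  have hφh : ∀ z, h (φ z) = h a + δ * z.im := fun z => by
    have : φ z - x = (a - x) + δ • L z := by
      rw [hφ, similarity_apply]; abel
    simp only [h, this, inner_add_left, inner_smul_left, hL]
    simp; ring
  have hstrip : ∀ p ∈ frontier G, |h p| * (δ * K) ≤ 2 * dist p x ^ 2 := fun p hp => by
    have e1 : dist p y ^ 2 - dist p x ^ 2 = 2 * d * h p := by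
      have : p - y = (p - x) + d • u := by rw [hdu]; abel
      rw [dist_eq_norm, dist_eq_norm, this, norm_add_sq_real, norm_smul, hu, inner_smul_right,
        Real.norm_of_nonneg hd0.le]
      simp only [h]
      ring
    have e2 := hsq p hp
    rw [e1, abs_mul, abs_of_pos (by positivity)] at e2
    have e3 : 4 * A * dist p x ^ 2 ≤ 4 * (d / δ / K) * dist p x ^ 2 := by gcongr
    have e4 : 4 * (d / δ / K) * dist p x ^ 2 * (δ * K) = 2 * d * (2 * dist p x ^ 2) := by
      field_simp; ring
    have e5 := mul_le_mul_of_nonneg_right (e2.trans e3) (show 0 ≤ δ * K by positivity)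
    rw [e4, mul_assoc] at e5
    exact le_of_mul_le_mul_left e5 (by positivity)
  have hha : |h a| * K ≤ 2 * δ := by
    have := hstrip a ha
    rw [hax] at this
    refine le_of_mul_le_mul_left ?_ hδ
    linarith
  have hnear : ∀ z : ℂ, ‖z‖ < 3 → φ z ∈ frontier G → |z.im| ≤ ε := fun z hz hzf => by
    have e1 : dist (φ z) x ≤ 4 * δ := by
      have := dist_triangle (φ z) a x
      rw [hφa, hax] at this
      nlinarith
    have e2 := hstrip _ hzf
    have e3 : |h (φ z)| * K ≤ 32 * δ := by
      refine le_of_mul_le_mul_left ?_ hδ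
      have : dist (φ z) x ^ 2 ≤ (4 * δ) ^ 2 := by gcongr
      linarith
    have e4 : δ * |z.im| ≤ |h (φ z)| + |h a| := by
      have : δ * |z.im| = |h (φ z) - h a| := by
        rw [hφh, add_sub_cancel_left, abs_mul, abs_of_pos hδ]
      rw [this]
      exact abs_sub _ _
    have e5 : δ * |z.im| * K ≤ δ * (K * ε) := by nlinarith
    have e6 : |z.im| * (δ * K) ≤ ε * (δ * K) := by linarith
    exact le_of_mul_le_mul_right e6 (by positivity)
  have hhaδ : |h a| ≤ δ / 50 := by nlinarith [abs_nonneg (h a)]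
  have side : ∀ (C : Set ℂ) (p : Euc 2), Convex ℝ C → (∀ z ∈ C, ‖z‖ < 3 ∧ ε < |z.im|) → p ∈ G →
      φ.symm p ∈ C → ∀ z ∈ C, φ z ∈ G := fun C p hC hCε hp hpC z hz => by
    refine subset_of_disjoint_frontier (hC.isPreconnected.image _ φ.continuous.continuousOn) hG
      ⟨p, ⟨_, hpC, φ.apply_symm_apply p⟩, hp⟩ ?_ ⟨z, hz, rfl⟩
    rintro _ ⟨w, hw, rfl⟩ hwf
    exact absurd (hnear w (hCε w hw).1 hwf) (not_le.2 (hCε w hw).2)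
  have hsymm : ∀ p, δ * ‖φ.symm p‖ = dist p a := fun p => by
    rw [← hφa, φ.apply_symm_apply]
  have hsymmh : ∀ p, h p = h a + δ * (φ.symm p).im := fun p => by
    rw [← hφh, φ.apply_symm_apply]
  have hhalf : ‖(δ / 2) • u‖ = δ / 2 := by
    rw [norm_smul, hu, mul_one, Real.norm_of_nonneg (by positivity)]
  have hab := abs_le.1 hhaδ
  refine ⟨a, ha, δ, hδ, L, fun z hz hzε => ?_, fun z hz hzε => ?_⟩
  · refine side (Metric.ball 0 3 ∩ {z : ℂ | ε < z.im}) (x + (δ / 2) • u)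
      ((convex_ball _ _).inter (convex_halfSpace_im_gt _))
      (fun w hw => ⟨by simpa using hw.1, lt_of_lt_of_le hw.2 (le_abs_self _)⟩)
      (ball_boundaryDist_subset hG hx ?_) ⟨?_, ?_⟩ z ⟨by simpa using hz, hzε⟩
    · rw [Metric.mem_ball, dist_self_add_left, hhalf, ← hδdef]; linarith
    · rw [mem_ball_zero_iff]
      refine lt_of_mul_lt_mul_left ?_ hδ.le
      have := dist_triangle (x + (δ / 2) • u) x a
      rw [dist_self_add_left, hhalf, dist_comm x a, hax] at this
      rw [hsymm]
      linarith
    · have e := hsymmh (x + (δ / 2) • u)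
      simp only [h, add_sub_cancel_left, inner_smul_left, huu] at e
      simp only [conj_trivial, mul_one] at e
      refine lt_of_mul_lt_mul_left ?_ hδ.le
      simp only [h] at hab
      nlinarith
  · refine side (Metric.ball 0 3 ∩ {z : ℂ | z.im < -ε}) (y - (δ / 2) • u)
      ((convex_ball _ _).inter (convex_halfSpace_im_lt _))
      (fun w hw => ⟨by simpa using hw.1, lt_of_lt_of_le (lt_neg_of_lt_neg hw.2) (neg_le_abs _)⟩)
      (ball_boundaryDist_subset hG hy ?_) ⟨?_, ?_⟩ z ⟨by simpa using hz, hzε⟩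
    · rw [Metric.mem_ball, dist_self_sub_left, hhalf]; linarith
    · rw [mem_ball_zero_iff]
      refine lt_of_mul_lt_mul_left ?_ hδ.le
      have e1 := dist_triangle (y - (δ / 2) • u) y a
      have e2 : dist a y < 2 * δ := by
        have := (le_abs_self _).trans (hsq a ha)
        rw [hax] at this
        refine lt_of_pow_lt_pow_left₀ 2 (by positivity) ?_
        nlinarith
      rw [dist_self_sub_left, hhalf, dist_comm y a] at e1
      rw [hsymm]
      linarith
    · have e := hsymmh (y - (δ / 2) • u)
      have : y - (δ / 2) • u - x = (-(d + δ / 2)) • u := by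
        rw [neg_smul, add_smul, hdu]; abel
      simp only [h, this, inner_smul_left, huu] at e
      simp only [conj_trivial, mul_one] at e
      change (φ.symm (y - (δ / 2) • u)).im < -ε
      refine lt_of_mul_lt_mul_left ?_ hδ.le
      simp only [h] at hab
      nlinarith

theorem exists_strip_of_not_dominated (hG : IsOpen G) (hproper : G ≠ univ)
    (hnot : ¬ Dominated G (jMetric G) (apollonian G)) {ε : ℝ} (hε : 0 < ε) (hε' : ε ≤ 1 / 4) :
    ∃ a ∈ frontier G, ∃ (δ : ℝ) (hδ : 0 < δ) (L : ℂ ≃ₗᵢ[ℝ] Euc 2),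
      (∀ z : ℂ, ‖z‖ < 3 → ε < z.im → similarity a hδ L z ∈ G) ∧
      (∀ z : ℂ, ‖z‖ < 3 → z.im < -ε → similarity a hδ L z ∈ G) := by
  set K : ℝ≥0 := 100 + 35 / ε.toNNReal
  have hKv : (K : ℝ) = 100 + 35 / ε := by simp [K, hε.le]
  have hK : 100 ≤ (K : ℝ) := by rw [hKv]; linarith [show 0 ≤ 35 / ε by positivity]
  have hKε : 35 ≤ (K : ℝ) * ε := by
    rw [hKv, add_mul, div_mul_cancel₀ _ hε.ne']; linarith
  have hK0 : 0 < K := by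
    rw [← NNReal.coe_pos]; linarith
  obtain ⟨x, hx, y, hy, hlt⟩ : ∃ x ∈ G, ∃ y ∈ G, K * apollonian G x y < jMetric G x y := by
    by_contra! h
    exact hnot ⟨K, hK0, h⟩
  wlog hle : boundaryDist G x ≤ boundaryDist G y generalizing x y
  · exact this y hy x hx (by rwa [apollonian_comm, jMetric_comm]) (le_of_not_ge hle)
  have hxy : x ≠ y := by
    rintro rfl
    simp [jMetric] at hlt
  refine exists_strip_of_le hG hproper hx hy hxy hle hK hKε hε' fun a ha b hb => ?_
  rw [le_div_iff₀' (by linarith)]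
  have h := (mul_le_mul_right (ofReal_log_le_apollonian ha hb x y) (K : ℝ≥0∞)).trans_lt hlt
  rw [← ENNReal.ofReal_coe_nnreal, ← ENNReal.ofReal_mul K.coe_nonneg, jMetric, min_eq_left hle] at h
  by_contra! h'
  exact absurd (ENNReal.ofReal_le_ofReal h'.le) (not_le.2 h)

theorem not_dominated_apollonianInner_jMetric (hG : IsOpen G) (hsc : IsSimplyConnected G)
    (hproper : G ≠ univ) (hnot : ¬ Dominated G (jMetric G) (apollonian G)) :
    ¬ Dominated G (apollonianInner G) (jMetric G) := by
  rintro ⟨K, -, hdom⟩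
  set M : ℝ := K * Real.log 5 + 1
  have hM : 0 ≤ M := by have := Real.log_nonneg (show (1 : ℝ) ≤ 5 by norm_num); positivity
  set ε : ℝ := Real.exp (-M) / 100
  have hε : 0 < ε := by positivity
  have hε1 : ε ≤ 1 / 100 :=
    div_le_div_of_nonneg_right (Real.exp_le_one_iff.2 (by linarith)) (by norm_num)
  obtain ⟨a, ha, δ, hδ, L, hup, hlo⟩ :=
    exists_strip_of_not_dominated hG hproper hnot hε (by linarith)
  obtain ⟨x, hx, y, hy, hj, hα⟩ :=
    exists_jMetric_le_and_le_apollonianInner hG hsc ha hδ L hε hε1 hup hlo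
  have h := hα.trans ((hdom x hx y hy).trans (mul_le_mul_right hj _))
  rw [← ENNReal.ofReal_coe_nnreal, ← ENNReal.ofReal_mul K.coe_nonneg,
    ENNReal.ofReal_le_ofReal_iff (mul_nonneg K.coe_nonneg (Real.log_nonneg (by norm_num)))] at h
  have h2 : M ≤ Real.log (1 / (16 * ε)) := by
    rw [Real.le_log_iff_exp_le (by positivity), le_div_iff₀ (by positivity)]
    have : Real.exp M * (16 * ε) = 16 / 100 * (Real.exp M * Real.exp (-M)) := by
      simp only [ε]; ring
    rw [this, ← Real.exp_add, add_neg_cancel, Real.exp_zero]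
    norm_num
  linarith [show M = K * Real.log 5 + 1 from rfl]

theorem Dominated.trans {n : ℕ} {G : Set (Euc n)} {d₁ d₂ d₃ : Euc n → Euc n → ℝ≥0∞}
    (h : Dominated G d₁ d₂) (h' : Dominated G d₂ d₃) : Dominated G d₁ d₃ := by
  obtain ⟨K, hK, h⟩ := h
  obtain ⟨K', hK', h'⟩ := h'
  refine ⟨K * K', mul_pos hK hK', fun x hx y hy => (h x hx y hy).trans ?_⟩
  rw [ENNReal.coe_mul, mul_assoc]
  exact mul_le_mul_right (h' x hx y hy) _

theorem dominated_innerMetric {n : ℕ} (G : Set (Euc n)) (d : Euc n → Euc n → ℝ≥0∞) :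
    Dominated G d (innerMetric G d) :=
  ⟨1, one_pos, fun x _ y _ => by simpa using le_innerMetric d x y⟩

theorem not_strictlyDominated_apollonianInner_jMetric (hG : IsOpen G) (hsc : IsSimplyConnected G)
    (hproper : G ≠ univ) : ¬ StrictlyDominated G (apollonianInner G) (jMetric G) := fun h =>
  not_dominated_apollonianInner_jMetric hG hsc hproper
    (fun hj => h.2 (hj.trans (dominated_innerMetric G _))) h.1

theorem not_dominated_of_not_comparisonProperty (hG : IsOpen G) (hsc : IsSimplyConnected G)
    (hproper : G ≠ univ) (hc : ¬ ComparisonProperty G) :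
    ¬ Dominated G (apollonianInner G) (jMetric G) := fun h =>
  not_dominated_apollonianInner_jMetric hG hsc hproper
    (fun hj => hc ⟨(dominated_innerMetric G _).trans h, hj⟩) h

end ApollonianGeometry

theorem mainTheorem4 (G : Set (ApollonianGeometry.Euc 2)) (hopen : IsOpen G)
    (hsc : IsSimplyConnected G) (hproper : G ≠ Set.univ) :
    (¬ ApollonianGeometry.ComparisonProperty G →
      ¬ ApollonianGeometry.Dominated G (ApollonianGeometry.apollonianInner G)
        (ApollonianGeometry.jMetric G)) ∧
    ¬ ApollonianGeometry.Inequality11 G ∧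
    ¬ ApollonianGeometry.Inequality12 G := by
  have hno := ApollonianGeometry.not_strictlyDominated_apollonianInner_jMetric hopen hsc hproper
  exact ⟨ApollonianGeometry.not_dominated_of_not_comparisonProperty hopen hsc hproper,
    fun h => hno h.2.1, fun h => hno h.2.1⟩
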